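/- Let $X$ be a complex Banach space, $1<\alpha<2$, and let $A:D(A)\subset X\to X$ be a closed, densely defined linear operator satisfying: (H1) $A$ is sectorial of type $\omega<0$ and angle $\theta$ with constant $M>0$, where $0<\theta<\pi(1-\frac{\alpha}{2})$. That is, with $\omega+S_\theta=\{\omega+\lambda:\lambda\in\mathbb C,\ |\arg(-\lambda)|<\theta\}$ (vertex $\omega$ included), every $\lambda\notin\omega+S_\theta$ lies in the resolvent set of $A$ and $\|(\lambda-A)^{-1}\|\le M/|\lambda-\omega|$. Let $S_\alpha(0)=I$ and, for $t>0$, $$S_\alpha(t)=\frac1{2\pi i}\int_\gamma e^{\lambda t}\lambda^{\alpha-1}(\lambda^\alpha-A)^{-1}\,d\lambda ,$$ where $\gamma$ is the path that runs from $\infty e^{-i\varphi}$ straight to $0$ and then straight to $\infty e^{i\varphi}$, for any fixed $\varphi>\pi/2$ with $\alpha\varphi<\pi-\theta$. Assume: (H3) $(S_\alpha(t))_{t\ge0}$ is strongly continuous. Then there is a constant $C>0$ such that $$\|S_\alpha(t)\|\le\frac{CM}{1+|\omega|t^\alpha}\qquad(t\ge0),\tag{1}$$ and the following holds for every $C>0$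 satisfying (1). Definitions. A bounded continuous $u:\mathbb R\to X$ is almost automorphic if every real sequence has a subsequence $(s_n)$ such that $g(t)=\lim_n u(t+s_n)$ exists and $\lim_n g(t-s_n)=u(t)$ for each $t\in\mathbb R$. It is asymptotically almost automorphic if $u=u_1+u_2$ with $u_1$ almost automorphic and $u_2$ bounded, continuous and $u_2(t)\to0$ as $t\to+\infty$. A function $f:\mathbb R\times X\times X\to X$ is asymptotically almost automorphic if $f=f_1+f_2$, where $f_1,f_2$ are continuous and bounded on $\mathbb R\times B$ for every bounded $B\subset X\times X$, such that: for every compact $Q\subset X\times X$, every real sequence has a subsequence $(s_n)$ for which $g(t,y)=\lim_n f_1(t+s_n,y)$ exists and $\lim_n g(t-s_n,y)=f_1(t,y)$ for all $t\in\mathbb R$, $y\in Q$; and $f_2(t,y)\to0$ as $t\to+\infty$, uniformly for $y$ in bounded subsets of $X\times X$. Let $k\in L^1(\mathbb R^+)$ (scalar-valued), $Ku(t)=\int_{-\infty}^t k(t-s)u(s)\,ds$, and assume: (H2) $f$ is asymptotically almost automorphic and there is $L_f>0$ with $\|f(t,u,\phi)-f(t,v,\psi)\|\le L_f(\|u-v\|+\|\phi-\psi\|)$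 for all $t\in\mathbb R$ and $u,v,\phi,\psi\in X$. If $$\Lambda=\frac{CM|\omega|^{-1/\alpha}\pi}{\alpha\sin(\pi/\alpha)}\,L_f\,(1+\|k\|_{L^1(\mathbb R^+)})<1,$$ then the fractional integro-differential equation ${}^{C}D_t^{\alpha}u(t)=Au(t)+{}^{C}D_t^{\alpha-1}f(t,u(t),Ku(t))$, $t\in\mathbb R$, has exactly one asymptotically almost automorphic mild solution, that is, there is exactly one asymptotically almost automorphic $u:\mathbb R\to X$ such that for each $t\in\mathbb R$ the functions $s\mapsto k(t-s)u(s)$ and $s\mapsto S_\alpha(t-s)f(s,u(s),Ku(s))$ are integrable on $(-\infty,t)$ and $$u(t)=\int_{-\infty}^t S_\alpha(t-s)f(s,u(s),Ku(s))\,ds .$$ -/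

import Mathlib

open Set Filter Topology MeasureTheory

noncomputable section

/-! ### Almost automorphic and asymptotically almost automorphic functions -/

/-- Bounded continuous `f : ℝ → X` is almost automorphic if every real sequence has a subsequence
`s ∘ σ` with `f (t + s (σ n)) → g t` and `g (t - s (σ n)) → f t` for each `t`. -/
def IsAA {X : Type*} [NormedAddCommGroup X] (f : ℝ → X) : Prop :=
  Continuous f ∧ (∃ c, ∀ t, ‖f t‖ ≤ c) ∧
    ∀ s : ℕ → ℝ, ∃ σ : ℕ → ℕ, StrictMono σ ∧ ∃ g : ℝ → X,
      (∀ t, Tendsto (fun n => f (t + s (σ n))) atTop (𝓝 (g t))) ∧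
      (∀ t, Tendsto (fun n => g (t - s (σ n))) atTop (𝓝 (f t)))

/-- Bounded continuous functions on `ℝ` that tend to `0` at `+∞`. -/
def IsCZero {X : Type*} [NormedAddCommGroup X] (h : ℝ → X) : Prop :=
  Continuous h ∧ (∃ c, ∀ t, ‖h t‖ ≤ c) ∧ Tendsto h atTop (𝓝 0)

/-- Asymptotically almost automorphic functions `ℝ → X`. -/
def IsAAA {X : Type*} [NormedAddCommGroup X] (f : ℝ → X) : Prop :=
  ∃ f₁ f₂ : ℝ → X, IsAA f₁ ∧ IsCZero f₂ ∧ ∀ t, f t = f₁ t + f₂ t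

/-- Jointly continuous and bounded on `ℝ × B` for every bounded set `B` of parameters. Every
bounded continuous function has this property. -/
def IsContBdd {Y X : Type*} [NormedAddCommGroup Y] [NormedAddCommGroup X] (f : ℝ → Y → X) : Prop :=
  Continuous (fun p : ℝ × Y => f p.1 p.2) ∧
    ∀ B : Set Y, Bornology.IsBounded B → ∃ c, ∀ t, ∀ y ∈ B, ‖f t y‖ ≤ c

/-- Almost automorphic in `t`, uniformly for the parameter in compact sets: the subsequence depends
only on the compact set and on the given sequence. -/
def IsAAParam {Y X : Type*} [NormedAddCommGroup Y] [NormedAddCommGroup X] (f : ℝ → Y → X) : Prop :=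
  IsContBdd f ∧
    ∀ K : Set Y, IsCompact K → ∀ s : ℕ → ℝ, ∃ σ : ℕ → ℕ, StrictMono σ ∧ ∃ g : ℝ → Y → X,
      (∀ t, ∀ y ∈ K, Tendsto (fun n => f (t + s (σ n)) y) atTop (𝓝 (g t y))) ∧
      (∀ t, ∀ y ∈ K, Tendsto (fun n => g (t - s (σ n)) y) atTop (𝓝 (f t y)))

/-- Functions of `(t, y)` that tend to `0` as `t → +∞`, uniformly for `y` in bounded sets. -/
def IsCZeroParam {Y X : Type*} [NormedAddCommGroup Y] [NormedAddCommGroup X]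
    (h : ℝ → Y → X) : Prop :=
  IsContBdd h ∧
    ∀ B : Set Y, Bornology.IsBounded B → TendstoUniformlyOn h (fun _ => 0) atTop B

/-- Asymptotically almost automorphic functions `ℝ × Y → X`. -/
def IsAAAParam {Y X : Type*} [NormedAddCommGroup Y] [NormedAddCommGroup X]
    (f : ℝ → Y → X) : Prop :=
  ∃ f₁ f₂ : ℝ → Y → X, IsAAParam f₁ ∧ IsCZeroParam f₂ ∧ ∀ t y, f t y = f₁ t y + f₂ t y

/-! ### Sectorial operators and the solution operator -/

section Operators

variable {X : Type*} [NormedAddCommGroup X] [NormedSpace ℂ X]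

/-- The bounded operator `R` is a two-sided inverse of `z - A : D(A) → X`. -/
def IsResolventAt (A : X →ₗ.[ℂ] X) (z : ℂ) (R : X →L[ℂ] X) : Prop :=
  (∀ x : X, ∃ y : A.domain, (y : X) = R x ∧ z • (y : X) - A y = x) ∧
    ∀ y : A.domain, R (z • (y : X) - A y) = y

open Classical in
/-- `(z - A)⁻¹`; the value is `0` if `z` is not in the resolvent set. -/
def resolventOp (A : X →ₗ.[ℂ] X) (z : ℂ) : X →L[ℂ] X :=
  if h : ∃ R, IsResolventAt A z R then h.choose else 0

/-- The sector `ω + S_θ = {ω + z : |arg (-z)| < θ}`. -/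
def shiftedSector (ω θ : ℝ) : Set ℂ := {z | |Complex.arg (-(z - (ω : ℂ)))| < θ}

/-- `A` is sectorial of type `ω` and angle `θ` with constant `M`. (The vertex `z = ω`, where the
right-hand side of the estimate is infinite, belongs to the sector here, since `arg 0 = 0 < θ`.) -/
structure IsSectorial (A : X →ₗ.[ℂ] X) (ω θ M : ℝ) : Prop where
  closed : A.IsClosed
  angle_pos : 0 < θ
  angle_lt : θ < Real.pi / 2
  const_pos : 0 < M
  resolvent_bound : ∀ z : ℂ, z ∉ shiftedSector ω θ →
    ∃ R : X →L[ℂ] X, IsResolventAt A z R ∧ ‖R‖ ≤ M / ‖z - (ω : ℂ)‖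

/-- The integrand `e^{zt} z^{α-1} (z^α - A)⁻¹`. -/
def solutionKernel (A : X →ₗ.[ℂ] X) (α t : ℝ) (z : ℂ) : X →L[ℂ] X :=
  (Complex.exp (z * (t : ℂ)) * z ^ ((α : ℂ) - 1)) • resolventOp A (z ^ (α : ℂ))

/-- The integral of `F` along the path that runs from `∞ e^{-iφ}` straight to `0` and then straight
to `∞ e^{iφ}`. -/
def wedgeIntegral (φ : ℝ) (F : ℂ → X →L[ℂ] X) : X →L[ℂ] X :=
  (∫ r in Ioi (0 : ℝ), Complex.exp (φ * Complex.I) • F (r * Complex.exp (φ * Complex.I)))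
    - ∫ r in Ioi (0 : ℝ), Complex.exp (-(φ * Complex.I)) • F (r * Complex.exp (-(φ * Complex.I)))

/-- The solution operator `S_α(t) = (2πi)⁻¹ ∫_γ e^{zt} z^{α-1} (z^α - A)⁻¹ dz` for `t > 0`, with `γ`
the path above, and `S_α(0) = I` (the contour integral does not converge absolutely at `t = 0`). -/
def solutionOp (A : X →ₗ.[ℂ] X) (α φ t : ℝ) : X →L[ℂ] X :=
  if t = 0 then ContinuousLinearMap.id ℂ X
  else (2 * (Real.pi : ℂ) * Complex.I)⁻¹ • wedgeIntegral φ (solutionKernel A α t)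

/-- `Ku(t) = ∫_{-∞}^t k(t-s) u(s) ds`. -/
def memoryOp (k : ℝ → ℂ) (u : ℝ → X) (t : ℝ) : X :=
  ∫ s in Iio t, k (t - s) • u s

/-- Mild solutions on `ℝ`: all the integrals converge absolutely and
`u(t) = ∫_{-∞}^t S(t-s) f(s, u(s), Ku(s)) ds` for every `t`. -/
def IsMildSolution (S : ℝ → X →L[ℂ] X) (k : ℝ → ℂ) (f : ℝ → X × X → X) (u : ℝ → X) : Prop :=
  (∀ t, IntegrableOn (fun s => k (t - s) • u s) (Iio t)) ∧
  (∀ t, IntegrableOn (fun s => S (t - s) (f s (u s, memoryOp k u s))) (Iio t)) ∧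
  ∀ t, u t = ∫ s in Iio t, S (t - s) (f s (u s, memoryOp k u s))

end Operators

end

/-!
On the rays of the contour, `z ^ α` keeps a positive distance from the sector, so
`‖(z ^ α - A)⁻¹‖` is bounded there and the Gamma integral gives `‖S_α(t)‖ = O(t ^ (-α))`. The
contour says nothing near `t = 0`, where strong continuity and the uniform boundedness principle
bound `S_α` instead. Hence `S_α` is an integrable kernel, and
`∫_0^∞ dt / (1 + |ω| t ^ α) = |ω| ^ (-1/α) π / (α sin (π/α))` turns the condition `Λ < 1` into the
statement that `u ↦ ∫_{-∞}^t S_α(t - s) f(s, u(s), Ku(s)) ds` contracts the sup norm.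

This map preserves asymptotic almost automorphy: convolution with an integrable kernel does by
dominated convergence, superposition by the Lipschitz condition. To apply Banach's fixed point
theorem one needs the asymptotically almost automorphic functions to be complete in the sup norm;
this holds because the almost automorphic part returns arbitrarily late to each of its values, and
so is bounded by the sup norm of the sum.
-/

open scoped NNReal

section DiagonalSubsequence

theorem exists_strictMono_forall_map_atTop {Q : ℕ → Filter ℕ → Prop} (anti : ∀ n, Antitone (Q n))
    (extract : ∀ (n : ℕ) (σ : ℕ → ℕ), StrictMono σ →
      ∃ τ : ℕ → ℕ, StrictMono τ ∧ Q n (map (σ ∘ τ) atTop)) :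
    ∃ δ : ℕ → ℕ, StrictMono δ ∧ ∀ n, Q n (map δ atTop) := by
  choose τ hτ hQ using extract
  let T : ℕ → {σ : ℕ → ℕ // StrictMono σ} := fun n =>
    Nat.rec ⟨id, strictMono_id⟩ (fun n σ => ⟨σ.1 ∘ τ n σ.1 σ.2, σ.2.comp (hτ n σ.1 σ.2)⟩) n
  have factor : ∀ n m, n ≤ m → ∃ ρ : ℕ → ℕ, StrictMono ρ ∧ (T m).1 = (T n).1 ∘ ρ := by
    intro n m hnm
    induction m, hnm using Nat.le_induction with
    | base => exact ⟨id, strictMono_id, rfl⟩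
    | succ m _ ih =>
      obtain ⟨ρ, hρ, h⟩ := ih
      exact ⟨ρ ∘ τ m (T m).1 (T m).2, hρ.comp (hτ _ _ _),
        congrArg (· ∘ τ m (T m).1 (T m).2) h⟩
  have diagonal_le : ∀ n, map (fun m => (T m).1 m) atTop ≤ map (T n).1 atTop := by
    intro n
    choose! ρ hρ hT using factor n
    have hρ_top : Tendsto (fun m => ρ m m) atTop atTop :=
      tendsto_atTop_mono' _ ((eventually_ge_atTop n).mono fun m hm => (hρ m hm).le_apply) tendsto_id
    refine (tendsto_map.comp hρ_top).congr' ?_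
    filter_upwards [eventually_ge_atTop n] with m hm
    exact (congrFun (hT m hm) m).symm
  exact ⟨fun n => (T n).1 n,
    strictMono_nat_of_lt_succ fun n => (T n).2 (n.lt_succ_self.trans_le (hτ n _ (T n).2).le_apply),
    fun n => anti n (diagonal_le (n + 1)) (hQ n _ (T n).2)⟩

end DiagonalSubsequence

section UniformLimits

theorem exists_tendstoUniformly_of_dist_le {ι κ X Y : Type*} [PseudoMetricSpace X]
    [PseudoMetricSpace Y] [CompleteSpace Y] {u : ℕ → ι → X} {v : ι → X} {w : ℕ → κ → Y}
    (huv : TendstoUniformly u v atTop)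
    (hw : ∀ m n c, (∀ t, dist (u m t) (u n t) ≤ c) → ∀ t, dist (w m t) (w n t) ≤ c) :
    ∃ W, TendstoUniformly w W atTop := by
  have hcauchy : UniformCauchySeqOn w atTop univ := by
    refine Metric.uniformCauchySeqOn_iff.2 fun ε hε => ?_
    obtain ⟨N, hN⟩ := Metric.uniformCauchySeqOn_iff.1
      (tendstoUniformlyOn_univ.2 huv).uniformCauchySeqOn (ε / 2) (half_pos hε)
    exact ⟨N, fun m hm n hn t _ => (hw m n (ε / 2)
      (fun t => (hN m hm n hn t (mem_univ t)).le) t).trans_lt (half_lt_self hε)⟩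
  choose W hW using fun t => cauchySeq_tendsto_of_complete (hcauchy.cauchySeq (mem_univ t))
  exact ⟨W, tendstoUniformlyOn_univ.1 (hcauchy.tendstoUniformlyOn_of_tendsto fun t _ => hW t)⟩

theorem exists_norm_le_of_tendstoUniformly {X ι κ : Type*} [SeminormedAddCommGroup X]
    {p : Filter κ} [p.NeBot] {f : κ → ι → X} {F : ι → X} (hf : ∀ n, ∃ c, ∀ t, ‖f n t‖ ≤ c)
    (hF : TendstoUniformly f F p) : ∃ c, ∀ t, ‖F t‖ ≤ c := by
  obtain ⟨n, hn⟩ := (Metric.tendstoUniformly_iff.1 hF 1 one_pos).exists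
  obtain ⟨c, hc⟩ := hf n
  refine ⟨c + 1, fun t => (norm_le_norm_add_norm_sub (f n t) (F t)).trans ?_⟩
  rw [norm_sub_rev, ← dist_eq_norm]
  exact add_le_add (hc t) (hn t).le

end UniformLimits

section ReturnsAlong

/-- The double limit in the definition of almost automorphy, along a filter of translations: the
translates of `f` converge to `g`, and translating `g` back recovers `f`. For a sequence `s` the
filter is `map s atTop`. -/
def ReturnsAlong {X : Type*} [TopologicalSpace X] (l : Filter ℝ) (f g : ℝ → X) : Prop :=
  (∀ t, Tendsto (fun r => f (t + r)) l (𝓝 (g t))) ∧ ∀ t, Tendsto (fun r => g (t - r)) l (𝓝 (f t))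

namespace ReturnsAlong

variable {X Y : Type*} {l l' : Filter ℝ}

theorem mono [TopologicalSpace X] {f g : ℝ → X} (h : ReturnsAlong l f g) (hl : l' ≤ l) :
    ReturnsAlong l' f g :=
  ⟨fun t => (h.1 t).mono_left hl, fun t => (h.2 t).mono_left hl⟩

theorem prodMk [TopologicalSpace X] [TopologicalSpace Y] {f g : ℝ → X} {f' g' : ℝ → Y}
    (h : ReturnsAlong l f g) (h' : ReturnsAlong l f' g') :
    ReturnsAlong l (fun t => (f t, f' t)) (fun t => (g t, g' t)) :=
  ⟨fun t => (h.1 t).prodMk_nhds (h'.1 t), fun t => (h.2 t).prodMk_nhds (h'.2 t)⟩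

theorem map_continuous [TopologicalSpace X] [TopologicalSpace Y] {f g : ℝ → X} {φ : X → Y}
    (h : ReturnsAlong l f g) (hφ : Continuous φ) :
    ReturnsAlong l (fun t => φ (f t)) (fun t => φ (g t)) :=
  ⟨fun t => (hφ.tendsto _).comp (h.1 t), fun t => (hφ.tendsto _).comp (h.2 t)⟩

theorem mem_of_isClosed [TopologicalSpace X] {f g : ℝ → X} [l.NeBot] (h : ReturnsAlong l f g)
    {s : Set X} (hs : IsClosed s) (hf : ∀ t, f t ∈ s) (t : ℝ) : g t ∈ s :=
  hs.mem_of_tendsto (h.1 t) (.of_forall fun _ => hf _)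

theorem exists_of_tendstoUniformly [PseudoMetricSpace X] [CompleteSpace X] {f g : ℕ → ℝ → X}
    {F : ℝ → X} [l.NeBot] (hfg : ∀ n, ReturnsAlong l (f n) (g n))
    (hF : TendstoUniformly f F atTop) : ∃ G, ReturnsAlong l F G := by
  obtain ⟨G, hgG⟩ := exists_tendstoUniformly_of_dist_le hF fun m n c hc t =>
    le_of_tendsto (((hfg m).1 t).dist ((hfg n).1 t)) (.of_forall fun r => hc (t + r))
  refine ⟨G, fun t => ?_, fun t => ?_⟩
  · exact (hF.comp fun r => t + r).tendsto_of_eventually_tendsto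
      (.of_forall fun n => (hfg n).1 t) (hgG.tendsto_at t)
  · exact (hgG.comp fun r => t - r).tendsto_of_eventually_tendsto
      (.of_forall fun n => (hfg n).2 t) (hF.tendsto_at t)

end ReturnsAlong

end ReturnsAlong

section AlmostAutomorphic

variable {X Y : Type*} [NormedAddCommGroup X] [NormedAddCommGroup Y]

namespace IsAA

theorem exists_returnsAlong {f : ℝ → X} (hf : IsAA f) (s : ℕ → ℝ) :
    ∃ σ : ℕ → ℕ, StrictMono σ ∧ ∃ g, ReturnsAlong (map (s ∘ σ) atTop) f g :=
  hf.2.2 s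

theorem of_returnsAlong {f : ℝ → X} (hc : Continuous f) (hb : ∃ c, ∀ t, ‖f t‖ ≤ c)
    (h : ∀ s : ℕ → ℝ, ∃ σ : ℕ → ℕ, StrictMono σ ∧ ∃ g, ReturnsAlong (map (s ∘ σ) atTop) f g) :
    IsAA f :=
  ⟨hc, hb, h⟩

theorem isCompact_closure_range {f : ℝ → X} (hf : IsAA f) : IsCompact (closure (range f)) := by
  refine IsSeqCompact.isCompact fun x hx => ?_
  have approx : ∀ n : ℕ, ∃ t, dist (x n) (f t) < 1 / ((n : ℝ) + 1) := fun n => by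
    obtain ⟨_, ⟨t, rfl⟩, ht⟩ := Metric.mem_closure_iff.1 (hx n) _ Nat.one_div_pos_of_nat
    exact ⟨t, ht⟩
  choose s hs using approx
  obtain ⟨σ, hσ, g, hg, -⟩ := hf.2.2 s
  have hg0 : Tendsto (fun n => f (s (σ n))) atTop (𝓝 (g 0)) := by simpa using hg 0
  refine ⟨g 0, mem_closure_of_tendsto hg0 (.of_forall fun n => mem_range_self _), σ, hσ,
    (tendsto_iff_of_dist ?_).2 hg0⟩
  exact squeeze_zero (fun _ => dist_nonneg) (fun n => (hs (σ n)).le)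
    (tendsto_one_div_add_atTop_nhds_zero_nat.comp hσ.tendsto_atTop)

theorem const (x : X) : IsAA fun _ => x :=
  of_returnsAlong continuous_const ⟨‖x‖, fun _ => le_rfl⟩ fun _ =>
    ⟨id, strictMono_id, fun _ => x, fun _ => tendsto_const_nhds, fun _ => tendsto_const_nhds⟩

theorem prodMk {f : ℝ → X} {g : ℝ → Y} (hf : IsAA f) (hg : IsAA g) :
    IsAA fun t => (f t, g t) := by
  obtain ⟨a, ha⟩ := hf.2.1
  obtain ⟨b, hb⟩ := hg.2.1
  refine of_returnsAlong (hf.1.prodMk hg.1) ⟨max a b, fun t => max_le_max (ha t) (hb t)⟩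
    fun s => ?_
  obtain ⟨σ, hσ, F, hF⟩ := hf.exists_returnsAlong s
  obtain ⟨τ, hτ, G, hG⟩ := hg.exists_returnsAlong (s ∘ σ)
  exact ⟨σ ∘ τ, hσ.comp hτ, _, (hF.mono (tendsto_map.comp hτ.tendsto_atTop)).prodMk hG⟩

theorem map_continuous {f : ℝ → X} (hf : IsAA f) {φ : X → Y} (hφ : Continuous φ) :
    IsAA fun t => φ (f t) := by
  refine of_returnsAlong (hφ.comp hf.1) ?_ fun s => ?_
  · obtain ⟨c, hc⟩ := hf.isCompact_closure_range.exists_bound_of_continuousOn hφ.continuousOn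
    exact ⟨c, fun t => hc _ (subset_closure (mem_range_self t))⟩
  · obtain ⟨σ, hσ, g, hg⟩ := hf.exists_returnsAlong s
    exact ⟨σ, hσ, _, hg.map_continuous hφ⟩

theorem sub {f g : ℝ → X} (hf : IsAA f) (hg : IsAA g) : IsAA fun t => f t - g t :=
  (hf.prodMk hg).map_continuous continuous_sub

theorem mem_of_add_tendsto_zero {f h : ℝ → X} (hf : IsAA f) (hh : Tendsto h atTop (𝓝 0))
    {s : Set X} (hs : IsClosed s) (hfh : ∀ᶠ t in atTop, f t + h t ∈ s) (t : ℝ) : f t ∈ s := by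
  obtain ⟨σ, hσ, g, hg, hg'⟩ := hf.2.2 fun n => (n : ℝ)
  have hgs : ∀ t, g t ∈ s := fun t => by
    have translate : Tendsto (fun n => t + (σ n : ℝ)) atTop atTop :=
      tendsto_atTop_add_const_left _ _ (tendsto_natCast_atTop_atTop.comp hσ.tendsto_atTop)
    refine hs.mem_of_tendsto ?_ (translate.eventually hfh)
    simpa using (hg t).add (hh.comp translate)
  exact hs.mem_of_tendsto (hg' t) (.of_forall fun _ => hgs _)

theorem of_tendstoUniformly [CompleteSpace X] {f : ℕ → ℝ → X} {F : ℝ → X}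
    (hf : ∀ n, IsAA (f n)) (hF : TendstoUniformly f F atTop) : IsAA F := by
  refine of_returnsAlong (hF.continuous (.of_forall fun n => (hf n).1))
    (exists_norm_le_of_tendstoUniformly (fun n => (hf n).2.1) hF) fun s => ?_
  obtain ⟨σ, hσ, h⟩ := exists_strictMono_forall_map_atTop
    (Q := fun n l => ∃ g, ReturnsAlong (map s l) (f n) g)
    (fun n _ _ hl ⟨g, hg⟩ => ⟨g, hg.mono (map_mono hl)⟩)
    (fun n σ _ => (hf n).exists_returnsAlong (s ∘ σ))
  choose g hg using h
  exact ⟨σ, hσ, ReturnsAlong.exists_of_tendstoUniformly hg hF⟩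

end IsAA

namespace IsCZero

theorem zero : IsCZero fun _ => (0 : X) :=
  ⟨continuous_const, ⟨0, fun _ => norm_zero.le⟩, tendsto_const_nhds⟩

theorem prodMk {f : ℝ → X} {g : ℝ → Y} (hf : IsCZero f) (hg : IsCZero g) :
    IsCZero fun t => (f t, g t) := by
  obtain ⟨a, ha⟩ := hf.2.1
  obtain ⟨b, hb⟩ := hg.2.1
  exact ⟨hf.1.prodMk hg.1, ⟨max a b, fun t => max_le_max (ha t) (hb t)⟩,
    hf.2.2.prodMk_nhds hg.2.2⟩

theorem add {f g : ℝ → X} (hf : IsCZero f) (hg : IsCZero g) : IsCZero fun t => f t + g t := by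
  obtain ⟨a, ha⟩ := hf.2.1
  obtain ⟨b, hb⟩ := hg.2.1
  exact ⟨hf.1.add hg.1, ⟨a + b, fun t => norm_add_le_of_le (ha t) (hb t)⟩,
    by simpa using hf.2.2.add hg.2.2⟩

theorem of_norm_le_mul {f : ℝ → X} {g : ℝ → Y} (hg : IsCZero g) (hf : Continuous f) {K : ℝ}
    (hfg : ∀ t, ‖f t‖ ≤ K * ‖g t‖) : IsCZero f := by
  obtain ⟨c, hc⟩ := hg.2.1
  refine ⟨hf, ⟨|K| * c, fun t => (hfg t).trans ?_⟩,
    squeeze_zero_norm hfg (by simpa using hg.2.2.norm.const_mul K)⟩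
  exact mul_le_mul (le_abs_self K) (hc t) (norm_nonneg _) (abs_nonneg K)

theorem of_tendstoUniformly {f : ℕ → ℝ → X} {F : ℝ → X} (hf : ∀ n, IsCZero (f n))
    (hF : TendstoUniformly f F atTop) : IsCZero F :=
  ⟨hF.continuous (.of_forall fun n => (hf n).1),
    exists_norm_le_of_tendstoUniformly (fun n => (hf n).2.1) hF,
    hF.tendsto_of_eventually_tendsto (.of_forall fun n => (hf n).2.2) tendsto_const_nhds⟩

end IsCZero

namespace IsAAA

theorem continuous {f : ℝ → X} (hf : IsAAA f) : Continuous f := by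
  obtain ⟨f₁, f₂, h₁, h₂, h⟩ := hf
  rw [funext h]
  exact h₁.1.add h₂.1

theorem exists_norm_le {f : ℝ → X} (hf : IsAAA f) : ∃ c, ∀ t, ‖f t‖ ≤ c := by
  obtain ⟨f₁, f₂, ⟨-, ⟨a, ha⟩, -⟩, ⟨-, ⟨b, hb⟩, -⟩, h⟩ := hf
  exact ⟨a + b, fun t => h t ▸ norm_add_le_of_le (ha t) (hb t)⟩

theorem zero : IsAAA fun _ => (0 : X) :=
  ⟨_, _, IsAA.const 0, IsCZero.zero, fun _ => (add_zero 0).symm⟩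

theorem prodMk {f : ℝ → X} {g : ℝ → Y} (hf : IsAAA f) (hg : IsAAA g) :
    IsAAA fun t => (f t, g t) := by
  obtain ⟨f₁, f₂, hf₁, hf₂, hf⟩ := hf
  obtain ⟨g₁, g₂, hg₁, hg₂, hg⟩ := hg
  exact ⟨_, _, hf₁.prodMk hg₁, hf₂.prodMk hg₂, fun t => Prod.ext (hf t) (hg t)⟩

theorem of_tendstoUniformly [CompleteSpace X] {u : ℕ → ℝ → X} {v : ℝ → X}
    (hu : ∀ n, IsAAA (u n)) (huv : TendstoUniformly u v atTop) : IsAAA v := by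
  choose f₁ f₂ h₁ h₂ hadd using hu
  obtain ⟨G, hf₁G⟩ : ∃ G, TendstoUniformly f₁ G atTop := by
    refine exists_tendstoUniformly_of_dist_le huv fun m n c hc t => ?_
    rw [dist_eq_norm, ← mem_closedBall_zero_iff]
    refine ((h₁ m).sub (h₁ n)).mem_of_add_tendsto_zero (h := fun t => f₂ m t - f₂ n t)
      (by simpa using (h₂ m).2.2.sub (h₂ n).2.2) Metric.isClosed_closedBall
      (.of_forall fun t => ?_) t
    rw [mem_closedBall_zero_iff, sub_add_sub_comm, ← hadd, ← hadd, ← dist_eq_norm]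
    exact hc t
  have hf₂G : TendstoUniformly f₂ (v - G) atTop := by
    have hf₂ : f₂ = u - f₁ := by
      ext n t
      simp [hadd]
    exact hf₂ ▸ huv.sub hf₁G
  exact ⟨G, v - G, .of_tendstoUniformly h₁ hf₁G, .of_tendstoUniformly h₂ hf₂G, fun t => by simp⟩

end IsAAA

end AlmostAutomorphic

section Superposition

variable {X Y : Type*}

theorem tendsto_apply_of_lipschitzOnWith [PseudoMetricSpace X] [PseudoMetricSpace Y] {ι : Type*}
    {l : Filter ι} {F : ι → Y → X} {K : ℝ≥0} {s : Set Y} (hF : ∀ i, LipschitzOnWith K (F i) s)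
    {w : ι → Y} {a : Y} (hw : Tendsto w l (𝓝 a)) (hws : ∀ i, w i ∈ s) (ha : a ∈ s) {x : X}
    (hx : Tendsto (fun i => F i a) l (𝓝 x)) : Tendsto (fun i => F i (w i)) l (𝓝 x) := by
  refine (tendsto_iff_of_dist ?_).2 hx
  refine squeeze_zero (fun _ => dist_nonneg) (fun i => (hF i).dist_le_mul _ (hws i) _ ha) ?_
  simpa using (tendsto_iff_dist_tendsto_zero.1 hw).const_mul (K : ℝ)

theorem ReturnsAlong.comp_lipschitzOnWith [PseudoMetricSpace X] [PseudoMetricSpace Y]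
    {l : Filter ℝ} [l.NeBot] {f g : ℝ → Y → X} {u v : ℝ → Y} {K : ℝ≥0} {s : Set Y}
    (hs : IsClosed s) (hf : ∀ t, LipschitzOnWith K (f t) s)
    (hfg : ∀ y ∈ s, ReturnsAlong l (fun t => f t y) fun t => g t y) (huv : ReturnsAlong l u v)
    (hu : ∀ t, u t ∈ s) : ReturnsAlong l (fun t => f t (u t)) fun t => g t (v t) := by
  have hv : ∀ t, v t ∈ s := huv.mem_of_isClosed hs hu
  have hg : ∀ t, LipschitzOnWith K (g t) s := fun t =>
    LipschitzOnWith.of_dist_le_mul fun y hy z hz =>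
      le_of_tendsto (((hfg y hy).1 t).dist ((hfg z hz).1 t))
        (.of_forall fun _ => (hf _).dist_le_mul y hy z hz)
  exact ⟨fun t => tendsto_apply_of_lipschitzOnWith (fun r => hf (t + r)) (huv.1 t)
      (fun _ => hu _) (hv t) ((hfg _ (hv t)).1 t),
    fun t => tendsto_apply_of_lipschitzOnWith (fun r => hg (t - r)) (huv.2 t)
      (fun _ => hv _) (hu t) ((hfg _ (hu t)).2 t)⟩

variable [NormedAddCommGroup X] [NormedAddCommGroup Y]

theorem IsContBdd.continuous_comp {f : ℝ → Y → X} (hf : IsContBdd f) {y : ℝ → Y}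
    (hy : Continuous y) : Continuous fun t => f t (y t) :=
  hf.1.comp (continuous_id.prodMk hy)

theorem IsContBdd.exists_norm_comp_le {f : ℝ → Y → X} (hf : IsContBdd f) {y : ℝ → Y}
    (hy : ∃ c, ∀ t, ‖y t‖ ≤ c) : ∃ c, ∀ t, ‖f t (y t)‖ ≤ c := by
  obtain ⟨r, hr⟩ := hy
  obtain ⟨c, hc⟩ := hf.2 (Metric.closedBall 0 r) Metric.isBounded_closedBall
  exact ⟨c, fun t => hc t _ (mem_closedBall_zero_iff.2 (hr t))⟩

theorem IsCZeroParam.isCZero_comp {h : ℝ → Y → X} (hh : IsCZeroParam h) {y : ℝ → Y}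
    (hy : Continuous y) (hb : ∃ c, ∀ t, ‖y t‖ ≤ c) : IsCZero fun t => h t (y t) := by
  refine ⟨hh.1.continuous_comp hy, hh.1.exists_norm_comp_le hb, ?_⟩
  obtain ⟨r, hr⟩ := hb
  refine Metric.tendsto_nhds.2 fun ε hε => ?_
  filter_upwards [Metric.tendstoUniformlyOn_iff.1 (hh.2 _ Metric.isBounded_closedBall) ε hε]
    with t ht
  rw [dist_comm]
  exact ht _ (mem_closedBall_zero_iff.2 (hr t))

namespace IsAAParam

theorem isAA_apply {f : ℝ → Y → X} (hf : IsAAParam f) (y : Y) : IsAA fun t => f t y := by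
  refine .of_returnsAlong (hf.1.continuous_comp continuous_const)
    (hf.1.exists_norm_comp_le ⟨‖y‖, fun _ => le_rfl⟩) fun s => ?_
  obtain ⟨σ, hσ, g, hg, hg'⟩ := hf.2 {y} isCompact_singleton s
  exact ⟨σ, hσ, fun t => g t y, fun t => hg t y rfl, fun t => hg' t y rfl⟩

theorem isAA_comp {f : ℝ → Y → X} (hf : IsAAParam f) {K : ℝ≥0}
    (hK : ∀ t, LipschitzWith K (f t)) {y : ℝ → Y} (hy : IsAA y) : IsAA fun t => f t (y t) := by
  refine .of_returnsAlong (hf.1.continuous_comp hy.1) (hf.1.exists_norm_comp_le hy.2.1)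
    fun s => ?_
  obtain ⟨σ, hσ, h, hyh⟩ := hy.exists_returnsAlong s
  obtain ⟨τ, hτ, g, hg, hg'⟩ := hf.2 _ hy.isCompact_closure_range (s ∘ σ)
  exact ⟨σ ∘ τ, hσ.comp hτ, _, ReturnsAlong.comp_lipschitzOnWith isClosed_closure
    (fun t => (hK t).lipschitzOnWith) (fun x hx => ⟨fun t => hg t x hx, fun t => hg' t x hx⟩)
    (hyh.mono (tendsto_map.comp hτ.tendsto_atTop)) fun t => subset_closure (mem_range_self t)⟩

theorem lipschitzWith_of_add {f₁ f₂ : ℝ → Y → X} (h₁ : IsAAParam f₁) (h₂ : IsCZeroParam f₂)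
    {K : ℝ≥0} (hK : ∀ t, LipschitzWith K fun y => f₁ t y + f₂ t y) (t : ℝ) :
    LipschitzWith K (f₁ t) := by
  refine LipschitzWith.of_dist_le_mul fun y z => ?_
  have h₂_tendsto : ∀ y, Tendsto (fun t => f₂ t y) atTop (𝓝 0) := fun y =>
    (h₂.isCZero_comp continuous_const ⟨‖y‖, fun _ => le_rfl⟩).2.2
  rw [dist_eq_norm, ← mem_closedBall_zero_iff]
  refine ((h₁.isAA_apply y).sub (h₁.isAA_apply z)).mem_of_add_tendsto_zero
    (h := fun t => f₂ t y - f₂ t z) (by simpa using (h₂_tendsto y).sub (h₂_tendsto z))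
    Metric.isClosed_closedBall (.of_forall fun t => ?_) t
  rw [mem_closedBall_zero_iff, sub_add_sub_comm, ← dist_eq_norm]
  exact (hK t).dist_le_mul y z

end IsAAParam

theorem IsAAAParam.isAAA_comp {f : ℝ → Y → X} (hf : IsAAAParam f) {K : ℝ≥0}
    (hK : ∀ t, LipschitzWith K (f t)) {y : ℝ → Y} (hy : IsAAA y) : IsAAA fun t => f t (y t) := by
  have hyc := hy.continuous
  have hyb := hy.exists_norm_le
  obtain ⟨f₁, f₂, h₁, h₂, hf⟩ := hf
  obtain ⟨y₁, y₂, hy₁, hy₂, hadd⟩ := hy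
  have hK₁ : ∀ t, LipschitzWith K (f₁ t) := by
    refine h₁.lipschitzWith_of_add h₂ fun t => ?_
    simpa only [← hf] using hK t
  have hfy₁ : IsAA fun t => f₁ t (y₁ t) := h₁.isAA_comp hK₁ hy₁
  have hdiff : IsCZero fun t => f₁ t (y t) - f₁ t (y₁ t) :=
    hy₂.of_norm_le_mul ((h₁.1.continuous_comp hyc).sub hfy₁.1) fun t => by
      simpa [hadd t] using (hK₁ t).norm_sub_le (y t) (y₁ t)
  refine ⟨_, _, hfy₁, hdiff.add (h₂.isCZero_comp hyc hyb), fun t => (hf t (y t)).trans ?_⟩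
  abel

end Superposition

section Convolution

theorem aestronglyMeasurable_apply_of_forall {α 𝕜 E F : Type*} [MeasurableSpace α] {μ : Measure α}
    [NontriviallyNormedField 𝕜] [NormedAddCommGroup E] [NormedSpace 𝕜 E] [NormedAddCommGroup F]
    [NormedSpace 𝕜 F] {T : α → E →L[𝕜] F} (hT : ∀ x, AEStronglyMeasurable (fun s => T s x) μ)
    {u : α → E} (hu : AEStronglyMeasurable u μ) : AEStronglyMeasurable (fun s => T s (u s)) μ := by
  have simple : ∀ φ : SimpleFunc α E, AEStronglyMeasurable (fun s => T s (φ s)) μ := by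
    intro φ
    induction φ using SimpleFunc.induction with
    | @const c B hB =>
      refine ((hT c).indicator hB).congr (.of_forall fun s => ?_)
      by_cases h : s ∈ B <;> simp [h]
    | add _ hf hg => exact (hf.add hg).congr (.of_forall fun s => by simp)
  have hmk : AEStronglyMeasurable (fun s => T s (hu.mk u s)) μ :=
    aestronglyMeasurable_of_tendsto_ae atTop (fun n => simple (hu.stronglyMeasurable_mk.approx n))
      (.of_forall fun s =>
        ((T s).continuous.tendsto _).comp (hu.stronglyMeasurable_mk.tendsto_approx s))
  exact hmk.congr (hu.ae_eq_mk.mono fun s hs => congrArg (T s) hs.symm)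

variable {𝕜 E F : Type*} [NontriviallyNormedField 𝕜] [NormedAddCommGroup E] [NormedSpace 𝕜 E]
  [NormedAddCommGroup F] [NormedSpace 𝕜 F]

/-- A strongly measurable family of bounded operators on `(0, ∞)` whose norm is dominated by the
integrable function `b`: the kernels for which `∫_0^∞ T(s) u(t - s) ds` is defined for every
bounded measurable `u`. Values of `T` and `b` on `(-∞, 0]` are irrelevant. -/
structure IsIntegrableKernel (T : ℝ → E →L[𝕜] F) (b : ℝ → ℝ) : Prop where
  aestronglyMeasurable : ∀ x, AEStronglyMeasurable (fun s => T s x) (volume.restrict (Ioi 0))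
  norm_le : ∀ s, 0 < s → ‖T s‖ ≤ b s
  integrableOn : IntegrableOn b (Ioi 0)

theorem integrableOn_Iio_iff_integrableOn_Ioi (T : ℝ → E →L[𝕜] F) (u : ℝ → E) (t : ℝ) :
    IntegrableOn (fun s => T (t - s) (u s)) (Iio t) ↔
      IntegrableOn (fun s => T s (u (t - s))) (Ioi 0) := by
  have h := (Measure.measurePreserving_sub_left volume t).integrableOn_comp_preimage
    (MeasurableEquiv.subLeft t).measurableEmbedding (f := fun s => T s (u (t - s))) (s := Ioi 0)
  simpa [Function.comp_def] using h

namespace IsIntegrableKernel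

variable {T : ℝ → E →L[𝕜] F} {b : ℝ → ℝ} {u : ℝ → E} {c : ℝ}

theorem aestronglyMeasurable_apply (hT : IsIntegrableKernel T b) (hu : StronglyMeasurable u)
    (t : ℝ) : AEStronglyMeasurable (fun s => T s (u (t - s))) (volume.restrict (Ioi 0)) :=
  aestronglyMeasurable_apply_of_forall hT.aestronglyMeasurable
    (hu.comp_measurable (by fun_prop)).aestronglyMeasurable

theorem ae_norm_apply_le (hT : IsIntegrableKernel T b) (hc : ∀ t, ‖u t‖ ≤ c) (t : ℝ) :
    ∀ᵐ s ∂volume.restrict (Ioi 0), ‖T s (u (t - s))‖ ≤ b s * c :=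
  (ae_restrict_iff' measurableSet_Ioi).2 (.of_forall fun s hs =>
    (T s).le_of_opNorm_le_of_le (hT.norm_le s hs) (hc _))

theorem integrableOn_apply (hT : IsIntegrableKernel T b) (hu : StronglyMeasurable u)
    (hc : ∀ t, ‖u t‖ ≤ c) (t : ℝ) : IntegrableOn (fun s => T s (u (t - s))) (Ioi 0) :=
  (hT.integrableOn.mul_const c).mono' (hT.aestronglyMeasurable_apply hu t)
    (hT.ae_norm_apply_le hc t)

end IsIntegrableKernel

variable [NormedSpace ℝ F]

/-- The causal convolution `∫_0^∞ T(s) u(t - s) ds = ∫_{-∞}^t T(t - s) u(s) ds`. -/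
noncomputable def kernelConv (T : ℝ → E →L[𝕜] F) (u : ℝ → E) (t : ℝ) : F :=
  ∫ s in Ioi (0 : ℝ), T s (u (t - s))

theorem setIntegral_Iio_eq_kernelConv (T : ℝ → E →L[𝕜] F) (u : ℝ → E) (t : ℝ) :
    ∫ s in Iio t, T (t - s) (u s) = kernelConv T u t := by
  have h := (Measure.measurePreserving_sub_left volume t).setIntegral_preimage_emb
    (MeasurableEquiv.subLeft t).measurableEmbedding (fun s => T s (u (t - s))) (Ioi 0)
  simpa [kernelConv] using h

theorem kernelConv_add_right (T : ℝ → E →L[𝕜] F) (u : ℝ → E) (t r : ℝ) :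
    kernelConv T u (t + r) = kernelConv T (fun s => u (s + r)) t := by
  simp only [kernelConv, sub_add_eq_add_sub]

namespace IsIntegrableKernel

variable {T : ℝ → E →L[𝕜] F} {b : ℝ → ℝ} {u v : ℝ → E} {c d : ℝ}

theorem norm_kernelConv_le (hT : IsIntegrableKernel T b) (hc : ∀ t, ‖u t‖ ≤ c) (t : ℝ) :
    ‖kernelConv T u t‖ ≤ (∫ s in Ioi (0 : ℝ), b s) * c := by
  rw [← integral_mul_const]
  exact norm_integral_le_of_norm_le (hT.integrableOn.mul_const c) (hT.ae_norm_apply_le hc t)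

theorem kernelConv_sub (hT : IsIntegrableKernel T b) (hu : StronglyMeasurable u)
    (hv : StronglyMeasurable v) (hc : ∀ t, ‖u t‖ ≤ c) (hd : ∀ t, ‖v t‖ ≤ d) (t : ℝ) :
    kernelConv T (fun s => u s - v s) t = kernelConv T u t - kernelConv T v t := by
  simp only [kernelConv, map_sub]
  exact integral_sub (hT.integrableOn_apply hu hc t) (hT.integrableOn_apply hv hd t)

theorem tendsto_kernelConv (hT : IsIntegrableKernel T b) {ι : Type*} {l : Filter ι}
    [l.IsCountablyGenerated] {u : ι → ℝ → E} {v : ℝ → E} (hu : ∀ i, StronglyMeasurable (u i))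
    (hc : ∀ i t, ‖u i t‖ ≤ c) (huv : ∀ t, Tendsto (fun i => u i t) l (𝓝 (v t))) (t : ℝ) :
    Tendsto (fun i => kernelConv T (u i) t) l (𝓝 (kernelConv T v t)) :=
  tendsto_integral_filter_of_dominated_convergence (fun s => b s * c)
    (.of_forall fun i => hT.aestronglyMeasurable_apply (hu i) t)
    (.of_forall fun i => hT.ae_norm_apply_le (hc i) t) (hT.integrableOn.mul_const c)
    (.of_forall fun s => ((T s).continuous.tendsto _).comp (huv (t - s)))

theorem continuous_kernelConv (hT : IsIntegrableKernel T b) (hu : Continuous u)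
    (hc : ∀ t, ‖u t‖ ≤ c) : Continuous (kernelConv T u) := by
  refine continuous_iff_continuousAt.2 fun t => ?_
  have h := hT.tendsto_kernelConv (u := fun t s => u (s + t)) (v := fun s => u (s + t)) (l := 𝓝 t)
    (fun t => (hu.comp (continuous_add_const t)).stronglyMeasurable) (fun _ _ => hc _)
    (fun s => (hu.comp (continuous_const_add s)).tendsto t) 0
  simpa only [ContinuousAt, ← kernelConv_add_right, zero_add] using h

theorem returnsAlong_kernelConv (hT : IsIntegrableKernel T b) {l : Filter ℝ} [l.NeBot]
    [l.IsCountablyGenerated] (hu : StronglyMeasurable u) (hc : ∀ t, ‖u t‖ ≤ c)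
    (huv : ReturnsAlong l u v) : ReturnsAlong l (kernelConv T u) (kernelConv T v) := by
  have translate : ∀ {w : ℝ → E}, StronglyMeasurable w →
      ∀ r, StronglyMeasurable fun s => w (s + r) :=
    fun hw r => hw.comp_measurable (measurable_add_const r)
  have hv : StronglyMeasurable v :=
    stronglyMeasurable_of_tendsto l (translate hu) (tendsto_pi_nhds.2 huv.1)
  have hvc : ∀ t, ‖v t‖ ≤ c := fun t => mem_closedBall_zero_iff.1 <|
    huv.mem_of_isClosed Metric.isClosed_closedBall (fun t => mem_closedBall_zero_iff.2 (hc t)) t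
  refine ⟨fun t => ?_, fun t => ?_⟩
  · simp only [kernelConv_add_right]
    exact hT.tendsto_kernelConv (translate hu) (fun _ _ => hc _) huv.1 t
  · simp only [sub_eq_add_neg, kernelConv_add_right]
    exact hT.tendsto_kernelConv (fun r => translate hv (-r)) (fun _ _ => hvc _) huv.2 t

theorem isAA_kernelConv (hT : IsIntegrableKernel T b) (hu : IsAA u) : IsAA (kernelConv T u) := by
  obtain ⟨c, hc⟩ := hu.2.1
  refine .of_returnsAlong (hT.continuous_kernelConv hu.1 hc) ⟨_, hT.norm_kernelConv_le hc⟩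
    fun s => ?_
  obtain ⟨σ, hσ, g, hg⟩ := hu.exists_returnsAlong s
  exact ⟨σ, hσ, _, hT.returnsAlong_kernelConv hu.1.stronglyMeasurable hc hg⟩

theorem isCZero_kernelConv (hT : IsIntegrableKernel T b) (hu : IsCZero u) :
    IsCZero (kernelConv T u) := by
  obtain ⟨c, hc⟩ := hu.2.1
  refine ⟨hT.continuous_kernelConv hu.1 hc, ⟨_, hT.norm_kernelConv_le hc⟩, ?_⟩
  have h := hT.tendsto_kernelConv (u := fun t s => u (s + t)) (v := fun _ => 0) (l := atTop)
    (fun t => (hu.1.comp (continuous_add_const t)).stronglyMeasurable) (fun _ _ => hc _)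
    (fun s => hu.2.2.comp (tendsto_atTop_add_const_left _ s tendsto_id)) 0
  have kernelConv_zero : kernelConv T (fun _ => 0) 0 = 0 := by simp [kernelConv]
  simpa only [← kernelConv_add_right, zero_add, kernelConv_zero] using h

theorem isAAA_kernelConv (hT : IsIntegrableKernel T b) (hu : IsAAA u) :
    IsAAA (kernelConv T u) := by
  have huc := hu.continuous.stronglyMeasurable
  obtain ⟨c, hc⟩ := hu.exists_norm_le
  obtain ⟨u₁, u₂, h₁, h₂, h⟩ := hu
  obtain ⟨d, hd⟩ := h₁.2.1
  refine ⟨_, _, hT.isAA_kernelConv h₁, hT.isCZero_kernelConv h₂, fun t => ?_⟩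
  have hu₂ : u₂ = fun t => u t - u₁ t := funext fun t => by rw [h, add_sub_cancel_left]
  rw [hu₂, hT.kernelConv_sub huc h₁.1.stronglyMeasurable hc hd, add_sub_cancel]

theorem norm_kernelConv_sub_le (hT : IsIntegrableKernel T b) (hu : IsAAA u) (hv : IsAAA v)
    (huv : ∀ t, ‖u t - v t‖ ≤ d) (t : ℝ) :
    ‖kernelConv T u t - kernelConv T v t‖ ≤ (∫ s in Ioi (0 : ℝ), b s) * d := by
  obtain ⟨c, hc⟩ := hu.exists_norm_le
  obtain ⟨c', hc'⟩ := hv.exists_norm_le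
  rw [← hT.kernelConv_sub hu.continuous.stronglyMeasurable hv.continuous.stronglyMeasurable hc hc']
  exact hT.norm_kernelConv_le huv t

end IsIntegrableKernel

end Convolution

section Integrals

open Real

theorem integrableOn_rpow_mul_exp_neg_mul_Ioi {a r : ℝ} (ha : 0 < a) (hr : 0 < r) :
    IntegrableOn (fun t : ℝ => t ^ (a - 1) * exp (-(r * t))) (Ioi 0) := by
  refine Integrable.of_integral_ne_zero ?_
  have := Gamma_pos_of_pos ha
  rw [integral_rpow_mul_exp_neg_mul_Ioi ha hr]
  positivity

theorem lintegral_rpow_mul_exp_neg_mul_Ioi {a r : ℝ} (ha : 0 < a) (hr : 0 < r) :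
    ∫⁻ t in Ioi (0 : ℝ), ENNReal.ofReal (t ^ (a - 1) * exp (-(r * t))) =
      ENNReal.ofReal ((1 / r) ^ a * Gamma a) := by
  rw [← integral_rpow_mul_exp_neg_mul_Ioi ha hr]
  exact (ofReal_integral_eq_lintegral_ofReal (integrableOn_rpow_mul_exp_neg_mul_Ioi ha hr)
    (ae_restrict_of_forall_mem measurableSet_Ioi fun t (ht : 0 < t) => by positivity)).symm

/-- Writing `1 / (1 + s) = ∫_0^∞ e^{-(1+s)x} dx` and exchanging the integrals gives
`Γ(a) Γ(1 - a)`. -/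
theorem lintegral_rpow_div_one_add {a : ℝ} (ha₀ : 0 < a) (ha₁ : a < 1) :
    ∫⁻ s in Ioi (0 : ℝ), ENNReal.ofReal (s ^ (a - 1) / (1 + s)) =
      ENNReal.ofReal (π / sin (π * a)) := by
  have inner_x : ∀ s ∈ Ioi (0 : ℝ), ENNReal.ofReal (s ^ (a - 1) / (1 + s)) =
      ∫⁻ x in Ioi (0 : ℝ), ENNReal.ofReal (s ^ (a - 1) * exp (-((1 + s) * x))) := by
    intro s (hs : 0 < s)
    have h := lintegral_rpow_mul_exp_neg_mul_Ioi one_pos (add_pos one_pos hs)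
    simp only [sub_self, rpow_zero, one_mul, rpow_one, Gamma_one, mul_one] at h
    simp_rw [ENNReal.ofReal_mul (rpow_nonneg hs.le _)]
    rw [lintegral_const_mul _ (by fun_prop), h, ← ENNReal.ofReal_mul (by positivity), mul_one_div]
  have inner_s : ∀ x ∈ Ioi (0 : ℝ),
      ∫⁻ s in Ioi (0 : ℝ), ENNReal.ofReal (s ^ (a - 1) * exp (-((1 + s) * x))) =
        ENNReal.ofReal (Gamma a) * ENNReal.ofReal (x ^ (1 - a - 1) * exp (-(1 * x))) := by
    intro x (hx : 0 < x)
    have factor : ∀ s : ℝ, s ^ (a - 1) * exp (-((1 + s) * x)) =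
        exp (-x) * (s ^ (a - 1) * exp (-(x * s))) := fun s => by
      rw [mul_left_comm, ← exp_add]; ring_nf
    simp_rw [factor, ENNReal.ofReal_mul (exp_nonneg _)]
    rw [lintegral_const_mul _ (by fun_prop), lintegral_rpow_mul_exp_neg_mul_Ioi ha₀ hx,
      ← ENNReal.ofReal_mul (by positivity),
      ← ENNReal.ofReal_mul (Gamma_pos_of_pos ha₀).le, one_div, inv_rpow hx.le, ← rpow_neg hx.le]
    ring_nf
  rw [setLIntegral_congr_fun measurableSet_Ioi inner_x, lintegral_lintegral_swap (by fun_prop),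
    setLIntegral_congr_fun measurableSet_Ioi inner_s, lintegral_const_mul _ (by fun_prop),
    lintegral_rpow_mul_exp_neg_mul_Ioi (sub_pos.2 ha₁) one_pos,
    ← ENNReal.ofReal_mul (Gamma_pos_of_pos ha₀).le, div_one, one_rpow, one_mul,
    Gamma_mul_Gamma_one_sub]

theorem integral_rpow_div_one_add {a : ℝ} (ha₀ : 0 < a) (ha₁ : a < 1) :
    ∫ s in Ioi (0 : ℝ), s ^ (a - 1) / (1 + s) = π / sin (π * a) := by
  have hsin : 0 < sin (π * a) :=
    sin_pos_of_pos_of_lt_pi (by positivity) (mul_lt_of_lt_one_right pi_pos ha₁)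
  rw [integral_eq_lintegral_of_nonneg_ae
      (ae_restrict_of_forall_mem measurableSet_Ioi fun s (hs : 0 < s) => by positivity)
      (Measurable.aestronglyMeasurable (by fun_prop)),
    lintegral_rpow_div_one_add ha₀ ha₁, ENNReal.toReal_ofReal (by positivity)]

theorem integral_one_div_one_add_mul_rpow {α w : ℝ} (hα : 1 < α) (hw : 0 < w) :
    ∫ t in Ioi (0 : ℝ), 1 / (1 + w * t ^ α) = w ^ (-(1 / α)) * π / (α * sin (π / α)) := by
  have hα₀ : 0 < α := one_pos.trans hα
  have hα₁ : α⁻¹ < 1 := inv_lt_one_of_one_lt₀ hα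
  have hα' : 0 < α⁻¹ := inv_pos.2 hα₀
  calc ∫ t in Ioi (0 : ℝ), 1 / (1 + w * t ^ α)
      = ∫ s in Ioi (0 : ℝ), (α⁻¹ * s ^ (α⁻¹ - 1)) • (1 / (1 + w * s)) := by
        rw [← integral_comp_rpow_Ioi_of_pos (g := fun t => 1 / (1 + w * t ^ α)) hα']
        refine setIntegral_congr_fun measurableSet_Ioi fun s (hs : 0 < s) => ?_
        simp only [rpow_inv_rpow hs.le hα₀.ne']
    _ = w ^ (-(1 / α)) / α * (w * ∫ s in Ioi (0 : ℝ), (w * s) ^ (α⁻¹ - 1) / (1 + w * s)) := by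
        rw [← mul_assoc, ← integral_const_mul]
        refine setIntegral_congr_fun measurableSet_Ioi fun s (hs : 0 < s) => ?_
        have hwpow : w ^ (-(1 / α)) * w * w ^ (α⁻¹ - 1) = 1 := by
          rw [rpow_sub hw, rpow_neg hw.le, one_div, rpow_one]
          field_simp
        simp only [mul_rpow hw.le hs.le, smul_eq_mul]
        linear_combination -(α⁻¹ * s ^ (α⁻¹ - 1) / (1 + w * s)) * hwpow
    _ = w ^ (-(1 / α)) / α * ∫ s in Ioi (0 : ℝ), s ^ (α⁻¹ - 1) / (1 + s) := by
        rw [integral_comp_mul_left_Ioi (fun s => s ^ (α⁻¹ - 1) / (1 + s)) 0 hw, mul_zero,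
          smul_eq_mul, mul_inv_cancel_left₀ hw.ne']
    _ = w ^ (-(1 / α)) * π / (α * sin (π / α)) := by
        rw [integral_rpow_div_one_add hα' hα₁, div_mul_div_comm, ← div_eq_mul_inv]

theorem integrableOn_one_div_one_add_mul_rpow {α w : ℝ} (hα : 1 < α) (hw : 0 < w) :
    IntegrableOn (fun t : ℝ => 1 / (1 + w * t ^ α)) (Ioi 0) := by
  have hsin : 0 < sin (π / α) :=
    sin_pos_of_pos_of_lt_pi (by positivity) (div_lt_self pi_pos hα)
  refine Integrable.of_integral_ne_zero ?_
  rw [integral_one_div_one_add_mul_rpow hα hw]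
  positivity

end Integrals

section ComplexPlane

open Complex

theorem abs_arg_add_ofReal_le (z : ℂ) {c : ℝ} (hc : 0 ≤ c) : |arg (z + c)| ≤ |arg z| := by
  lift c to ℝ≥0 using hc
  rcases eq_or_ne z 0 with rfl | hz
  · simp [arg_ofReal_of_nonneg c.coe_nonneg]
  rcases eq_or_ne (z + c) 0 with h0 | h0
  · simp [h0]
  have hspan : z + c ∈ Submodule.span ℝ≥0 {z, 1} :=
    Submodule.mem_span_pair.2 ⟨1, c, by simp [NNReal.smul_def]⟩
  rw [← angle_one_right h0, ← angle_one_right hz,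
    InnerProductGeometry.angle_eq_angle_add_add_angle_add_of_mem_span h0 hspan]
  exact le_add_of_nonneg_left (InnerProductGeometry.angle_nonneg _ _)

theorem abs_arg_neg {z : ℂ} (hz : z ≠ 0) : |arg (-z)| = Real.pi - |arg z| := by
  rw [← angle_one_right hz, ← angle_one_right (neg_ne_zero.2 hz),
    InnerProductGeometry.angle_neg_left]

theorem arg_cpow_ofReal {z : ℂ} (hz : z ≠ 0) {α : ℝ} (h : |α * arg z| < Real.pi) :
    arg (z ^ (α : ℂ)) = α * arg z := by
  have h' := abs_lt.1 h
  rw [cpow_ofReal, mul_comm (arg z), ofReal_cos, ofReal_sin,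
    arg_mul_cos_add_sin_mul_I (Real.rpow_pos_of_pos (norm_pos_iff.2 hz) α) ⟨h'.1, h'.2.le⟩]

theorem arg_ofReal_mul_exp_mul_I {r ψ : ℝ} (hr : 0 < r) (hψ : |ψ| < Real.pi) :
    arg (r * exp (ψ * I)) = ψ := by
  rw [exp_mul_I, arg_mul_cos_add_sin_mul_I hr ⟨(abs_lt.1 hψ).1, (abs_lt.1 hψ).2.le⟩]

theorem norm_ofReal_mul_exp_mul_I {r : ℝ} (hr : 0 ≤ r) (ψ : ℝ) : ‖r * exp (ψ * I)‖ = r := by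
  rw [norm_mul, norm_exp_ofReal_mul_I, mul_one, norm_real, Real.norm_of_nonneg hr]

theorem abs_mul_sin_arg_le_norm_sub (z : ℂ) (c : ℝ) : |c * Real.sin (arg z)| ≤ ‖z - c‖ := by
  have rotate : (z - c) * exp ((-arg z : ℝ) * I) = ‖z‖ - c * exp ((-arg z : ℝ) * I) := by
    rw [sub_mul]
    nth_rw 1 [← norm_mul_exp_arg_mul_I z]
    rw [mul_assoc, ← exp_add, ofReal_neg, neg_mul, add_neg_cancel, exp_zero, mul_one]
  calc |c * Real.sin (arg z)| = |((z - c) * exp ((-arg z : ℝ) * I)).im| := by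
        rw [rotate, sub_im, ofReal_im, im_ofReal_mul, exp_ofReal_mul_I_im, Real.sin_neg, mul_neg,
          zero_sub, neg_neg]
    _ ≤ ‖(z - c) * exp ((-arg z : ℝ) * I)‖ := abs_im_le_norm _
    _ = ‖z - c‖ := by rw [norm_mul, norm_exp_ofReal_mul_I, mul_one]

theorem notMem_shiftedSector_of_abs_arg_le {ω θ : ℝ} (hω : ω < 0) {z : ℂ}
    (hz : |arg z| ≤ Real.pi - θ) : z ∉ shiftedSector ω θ := by
  suffices θ ≤ |arg (-(z - ω))| from this.not_gt
  rcases eq_or_ne z ω with rfl | hne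
  · rw [arg_ofReal_of_neg hω, abs_of_pos Real.pi_pos] at hz
    rw [sub_self, neg_zero, arg_zero, abs_zero]
    linarith
  · have hle : |arg (z - ω)| ≤ |arg z| := by
      simpa [sub_eq_add_neg] using abs_arg_add_ofReal_le z (neg_nonneg.2 hω.le)
    rw [abs_arg_neg (sub_ne_zero.2 hne)]
    linarith

end ComplexPlane

section SolutionOperator

open Real

theorem exists_forall_le_div_one_add_mul_rpow {g : ℝ → ℝ} {B D w α : ℝ} (hα : 0 ≤ α) (hw : 0 ≤ w)
    (hB : ∀ t ∈ Icc (0 : ℝ) 1, g t ≤ B) (hD : ∀ t, 1 ≤ t → g t ≤ D / t ^ α) :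
    ∃ C, 0 < C ∧ ∀ t, 0 ≤ t → g t ≤ C / (1 + w * t ^ α) := by
  have hK : 0 < max 1 (max B D) := lt_max_of_lt_left one_pos
  have hBK : B ≤ max 1 (max B D) := (le_max_left _ _).trans (le_max_right _ _)
  have hDK : D ≤ max 1 (max B D) := (le_max_right _ _).trans (le_max_right _ _)
  generalize max 1 (max B D) = K at hK hBK hDK
  refine ⟨K * (1 + w), by positivity, fun t ht => ?_⟩
  rcases le_total t 1 with h1 | h1
  · calc g t ≤ K := (hB t ⟨ht, h1⟩).trans hBK
      _ = K * (1 + w) / (1 + w * 1) := by field_simp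
      _ ≤ K * (1 + w) / (1 + w * t ^ α) := by
        gcongr
        exact rpow_le_one ht h1 hα
  · have h1α : 1 ≤ t ^ α := one_le_rpow h1 hα
    calc g t ≤ K / t ^ α := (hD t h1).trans (by gcongr)
      _ = K * (1 + w) / (t ^ α + w * t ^ α) := by field_simp
      _ ≤ K * (1 + w) / (1 + w * t ^ α) := by gcongr

variable {X : Type*} [NormedAddCommGroup X] [NormedSpace ℂ X]

theorem IsResolventAt.unique {A : X →ₗ.[ℂ] X} {z : ℂ} {R R' : X →L[ℂ] X}
    (h : IsResolventAt A z R) (h' : IsResolventAt A z R') : R = R' := by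
  ext x
  obtain ⟨y, hy, hyx⟩ := h.1 x
  rw [← hy, ← h'.2 y, hyx]

namespace IsSectorial

variable {A : X →ₗ.[ℂ] X} {ω θ M α φ ψ t : ℝ}

theorem norm_resolventOp_le (hA : IsSectorial A ω θ M) {z : ℂ} (hz : z ∉ shiftedSector ω θ) :
    ‖resolventOp A z‖ ≤ M / ‖z - ω‖ := by
  obtain ⟨R, hR, hle⟩ := hA.resolvent_bound z hz
  have hex : ∃ R, IsResolventAt A z R := ⟨R, hR⟩
  rw [resolventOp, dif_pos hex, hex.choose_spec.unique hR]
  exact hle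

theorem norm_solutionKernel_le (hA : IsSectorial A ω θ M) (hω : ω < 0) {z : ℂ} (hz : z ≠ 0)
    (harg : |α * z.arg| ≤ π - θ) (hsin : sin (α * z.arg) ≠ 0) (t : ℝ) :
    ‖solutionKernel A α t z‖ ≤
      ‖z‖ ^ (α - 1) * exp (-(-(t * cos z.arg) * ‖z‖)) * (M / |ω * sin (α * z.arg)|) := by
  have harg_pow : (z ^ (α : ℂ)).arg = α * z.arg :=
    arg_cpow_ofReal hz (by linarith [hA.angle_pos])
  have hres : ‖resolventOp A (z ^ (α : ℂ))‖ ≤ M / |ω * sin (α * z.arg)| := by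
    refine (hA.norm_resolventOp_le
      (notMem_shiftedSector_of_abs_arg_le hω (harg_pow ▸ harg))).trans ?_
    refine div_le_div_of_nonneg_left hA.const_pos.le (abs_pos.2 (mul_ne_zero hω.ne hsin)) ?_
    exact harg_pow ▸ abs_mul_sin_arg_le_norm_sub (z ^ (α : ℂ)) ω
  have hexp : ‖Complex.exp (z * t)‖ = exp (-(-(t * cos z.arg) * ‖z‖)) := by
    rw [Complex.norm_exp, Complex.re_mul_ofReal, ← Complex.norm_mul_cos_arg]
    ring_nf
  have hpow : ‖z ^ ((α : ℂ) - 1)‖ = ‖z‖ ^ (α - 1) := by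
    exact_mod_cast Complex.norm_cpow_real z (α - 1)
  rw [solutionKernel, norm_smul, norm_mul, hexp, hpow, mul_comm (exp _)]
  gcongr

theorem norm_integral_solutionKernel_ray_le (hA : IsSectorial A ω θ M) (hω : ω < 0) (hα : 0 < α)
    (hψ : |ψ| < π) (hcos : cos ψ < 0) (harg : |α * ψ| ≤ π - θ) (hsin : sin (α * ψ) ≠ 0)
    (ht : 0 < t) :
    ‖∫ r in Ioi (0 : ℝ), Complex.exp (ψ * Complex.I) •
        solutionKernel A α t (r * Complex.exp (ψ * Complex.I))‖ ≤
      (1 / -(t * cos ψ)) ^ α * Gamma α * (M / |ω * sin (α * ψ)|) := by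
  have hdecay : 0 < -(t * cos ψ) := neg_pos.2 (mul_neg_of_pos_of_neg ht hcos)
  rw [← integral_rpow_mul_exp_neg_mul_Ioi hα hdecay, ← integral_mul_const]
  refine norm_integral_le_of_norm_le
    ((integrableOn_rpow_mul_exp_neg_mul_Ioi hα hdecay).mul_const _)
    (ae_restrict_of_forall_mem measurableSet_Ioi fun r (hr : 0 < r) => ?_)
  have h := hA.norm_solutionKernel_le (α := α) (z := r * Complex.exp (ψ * Complex.I)) hω
    (by simp [hr.ne'])
  rw [arg_ofReal_mul_exp_mul_I hr hψ, norm_ofReal_mul_exp_mul_I hr.le] at h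
  rw [norm_smul, Complex.norm_exp_ofReal_mul_I, one_mul]
  exact h harg hsin t

theorem norm_solutionOp_le_div_rpow (hA : IsSectorial A ω θ M) (hω : ω < 0) (hα : 0 < α)
    (hφ₁ : π / 2 < φ) (hφ : φ < π) (hφ₂ : α * φ ≤ π - θ) (ht : 0 < t) :
    ‖solutionOp A α φ t‖ ≤
      π⁻¹ * ((1 / -cos φ) ^ α * Gamma α * (M / |ω * sin (α * φ)|)) / t ^ α := by
  have hφ₀ : 0 < φ := pi_div_two_pos.trans hφ₁
  have hcos : cos φ < 0 := cos_neg_of_pi_div_two_lt_of_lt hφ₁ (by linarith)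
  have hsin : sin (α * φ) ≠ 0 :=
    (sin_pos_of_pos_of_lt_pi (by positivity) (by linarith [hA.angle_pos])).ne'
  have hφ' : |φ| < π := by rwa [abs_of_pos hφ₀]
  have harg : |α * φ| ≤ π - θ := by rwa [abs_of_pos (by positivity)]
  have upper := hA.norm_integral_solutionKernel_ray_le hω hα hφ' hcos harg hsin ht
  have lower := hA.norm_integral_solutionKernel_ray_le (ψ := -φ) hω hα (by rwa [abs_neg])
    (by rwa [cos_neg]) (by rwa [mul_neg, abs_neg]) (by rwa [mul_neg, sin_neg, neg_ne_zero]) ht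
  simp only [cos_neg, mul_neg, sin_neg, abs_neg, Complex.ofReal_neg, neg_mul] at lower
  have hscale : (1 / -(t * cos φ)) ^ α = (1 / -cos φ) ^ α / t ^ α := by
    rw [← mul_neg, mul_comm, ← div_div, div_rpow (one_div_nonneg.2 (neg_pos.2 hcos).le) ht.le]
  rw [solutionOp, if_neg ht.ne', norm_smul, wedgeIntegral]
  calc ‖(2 * (π : ℂ) * Complex.I)⁻¹‖ * _
      ≤ (2 * π)⁻¹ * ((1 / -(t * cos φ)) ^ α * Gamma α * (M / |ω * sin (α * φ)|) +
          (1 / -(t * cos φ)) ^ α * Gamma α * (M / |ω * sin (α * φ)|)) := by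
        refine mul_le_mul (by simp [abs_of_pos pi_pos])
          ((norm_sub_le _ _).trans (add_le_add upper lower)) (norm_nonneg _) (by positivity)
    _ = _ := by rw [hscale]; ring

theorem exists_norm_solutionOp_le [CompleteSpace X] (hA : IsSectorial A ω θ M) (hω : ω < 0)
    (hα : 1 < α) (hφ₁ : π / 2 < φ) (hφ₂ : α * φ < π - θ)
    (hS : ∀ x : X, ContinuousOn (fun t => solutionOp A α φ t x) (Ici 0)) :
    ∃ C : ℝ, 0 < C ∧ ∀ t : ℝ, 0 ≤ t → ‖solutionOp A α φ t‖ ≤ C * M / (1 + |ω| * t ^ α) := by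
  have hα₀ : 0 < α := one_pos.trans hα
  have hφ : φ < π := by nlinarith [hA.angle_pos, pi_pos]
  have bounded_near_zero : ∃ B, ∀ t : Icc (0 : ℝ) 1, ‖solutionOp A α φ t‖ ≤ B := by
    refine banach_steinhaus fun x => ?_
    obtain ⟨c, hc⟩ := isCompact_Icc.exists_bound_of_continuousOn ((hS x).mono Icc_subset_Ici_self)
    exact ⟨c, fun t => hc t t.2⟩
  obtain ⟨B, hB⟩ := bounded_near_zero
  obtain ⟨C, hC₀, hC⟩ := exists_forall_le_div_one_add_mul_rpow (w := |ω|) hα₀.le (abs_nonneg ω)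
    (fun t ht => hB ⟨t, ht⟩)
    (fun t ht => hA.norm_solutionOp_le_div_rpow hω hα₀ hφ₁ hφ hφ₂.le (one_pos.trans_le ht))
  refine ⟨C / M, div_pos hC₀ hA.const_pos, fun t ht => ?_⟩
  rw [div_mul_cancel₀ _ hA.const_pos.ne']
  exact hC t ht

end IsSectorial

end SolutionOperator

section FixedPoint

open BoundedContinuousFunction

theorem isClosed_setOf_isAAA {X : Type*} [NormedAddCommGroup X] [CompleteSpace X] :
    IsClosed {u : ℝ →ᵇ X | IsAAA u} :=
  IsSeqClosed.isClosed fun _ _ hu huv =>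
    IsAAA.of_tendstoUniformly hu (tendsto_iff_tendstoUniformly.1 huv)

theorem existsUnique_isAAA_fixedPoint {X : Type*} [NormedAddCommGroup X] [CompleteSpace X]
    {Φ : (ℝ → X) → ℝ → X} {q : ℝ≥0} (hq : q < 1) (hΦ : ∀ u, IsAAA u → IsAAA (Φ u))
    (hdist : ∀ u v e, IsAAA u → IsAAA v → (∀ t, ‖u t - v t‖ ≤ e) →
      ∀ t, ‖Φ u t - Φ v t‖ ≤ q * e) :
    ∃! u, IsAAA u ∧ Φ u = u := by
  let V := {u : ℝ →ᵇ X | IsAAA u}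
  have : CompleteSpace V := isClosed_setOf_isAAA.completeSpace_coe
  have : Nonempty V := ⟨⟨0, .zero⟩⟩
  let toV (u : ℝ → X) (hu : IsAAA u) : V :=
    ⟨ofNormedAddCommGroup u hu.continuous hu.exists_norm_le.choose hu.exists_norm_le.choose_spec,
      hu⟩
  let Ψ : V → V := fun u => toV (Φ u.1) (hΦ u.1 u.2)
  have hΨ : ContractingWith q Ψ := by
    refine ⟨hq, LipschitzWith.of_dist_le_mul fun u v => ?_⟩
    refine (dist_le (mul_nonneg q.coe_nonneg dist_nonneg)).2 fun t => ?_
    rw [dist_eq_norm]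
    refine hdist u.1 v.1 _ u.2 v.2 (fun t => ?_) t
    rw [← dist_eq_norm]
    exact dist_coe_le_dist (f := u.1) (g := v.1) t
  have coe_injective : Function.Injective fun u : V => (u.1 : ℝ → X) :=
    DFunLike.coe_injective.comp Subtype.val_injective
  exact ⟨hΨ.fixedPoint.1, ⟨hΨ.fixedPoint.2, congrArg (fun u : V => (u.1 : ℝ → X))
    hΨ.fixedPoint_isFixedPt⟩, fun v ⟨hv, hfix⟩ => congrArg (fun u : V => (u.1 : ℝ → X))
    (hΨ.fixedPoint_unique (x := toV v hv) (coe_injective hfix))⟩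

theorem lipschitzWith_of_norm_sub_le_mul_add {E F G : Type*} [NormedAddCommGroup E]
    [NormedAddCommGroup F] [NormedAddCommGroup G] {g : E × F → G} {L : ℝ≥0}
    (h : ∀ u v x y, ‖g (u, x) - g (v, y)‖ ≤ L * (‖u - v‖ + ‖x - y‖)) :
    LipschitzWith (L * 2) g := by
  refine LipschitzWith.of_dist_le_mul fun y z => ?_
  rw [dist_eq_norm, dist_eq_norm, NNReal.coe_mul, mul_assoc]
  refine (h y.1 z.1 y.2 z.2).trans (mul_le_mul_of_nonneg_left ?_ L.coe_nonneg)
  simpa [two_mul] using add_le_add (norm_fst_le (y - z)) (norm_snd_le (y - z))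

variable {X : Type*} [NormedAddCommGroup X] [NormedSpace ℂ X]

theorem isIntegrableKernel_smul_id {k : ℝ → ℂ} (hk : IntegrableOn k (Ioi 0)) :
    IsIntegrableKernel (fun s => k s • ContinuousLinearMap.id ℂ X) (fun s => ‖k s‖) where
  aestronglyMeasurable x := hk.aestronglyMeasurable.smul aestronglyMeasurable_const
  norm_le s _ := by
    rw [norm_smul]
    exact mul_le_of_le_one_right (norm_nonneg _) ContinuousLinearMap.norm_id_le
  integrableOn := hk.norm

theorem memoryOp_eq_kernelConv (k : ℝ → ℂ) (u : ℝ → X) :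
    memoryOp k u = kernelConv (fun s => k s • ContinuousLinearMap.id ℂ X) u :=
  funext fun t => setIntegral_Iio_eq_kernelConv (fun s => k s • ContinuousLinearMap.id ℂ X) u t

theorem isAAA_memoryOp {k : ℝ → ℂ} (hk : IntegrableOn k (Ioi 0)) {u : ℝ → X} (hu : IsAAA u) :
    IsAAA (memoryOp k u) :=
  memoryOp_eq_kernelConv k u ▸ (isIntegrableKernel_smul_id hk).isAAA_kernelConv hu

/-- The map `u ↦ ∫_{-∞}^t S(t - s) f(s, u(s), Ku(s)) ds` on functions `ℝ → X`, whose fixed points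
are the mild solutions. -/
noncomputable def mildMap (S : ℝ → X →L[ℂ] X) (k : ℝ → ℂ) (f : ℝ → X × X → X) (u : ℝ → X) :
    ℝ → X :=
  kernelConv S fun s => f s (u s, memoryOp k u s)

variable {S : ℝ → X →L[ℂ] X} {b : ℝ → ℝ} {k : ℝ → ℂ} {f : ℝ → X × X → X} {u v : ℝ → X}
  {L : ℝ≥0}

theorem isAAA_superposition_memoryOp (hk : IntegrableOn k (Ioi 0)) (hf : IsAAAParam f)
    (hL : ∀ t, LipschitzWith L (f t)) (hu : IsAAA u) :
    IsAAA fun t => f t (u t, memoryOp k u t) :=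
  hf.isAAA_comp hL (hu.prodMk (isAAA_memoryOp hk hu))

theorem isMildSolution_iff_mildMap_eq (hS : IsIntegrableKernel S b) (hk : IntegrableOn k (Ioi 0))
    (hf : IsAAAParam f) (hL : ∀ t, LipschitzWith L (f t)) (hu : IsAAA u) :
    IsMildSolution S k f u ↔ mildMap S k f u = u := by
  have hfu := isAAA_superposition_memoryOp hk hf hL hu
  obtain ⟨c, hc⟩ := hu.exists_norm_le
  obtain ⟨d, hd⟩ := hfu.exists_norm_le
  have integrable_memory : ∀ t, IntegrableOn (fun s => k (t - s) • u s) (Iio t) := fun t =>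
    (integrableOn_Iio_iff_integrableOn_Ioi (fun s => k s • ContinuousLinearMap.id ℂ X) u t).2 <|
      (isIntegrableKernel_smul_id hk).integrableOn_apply hu.continuous.stronglyMeasurable hc t
  have integrable_mild : ∀ t,
      IntegrableOn (fun s => S (t - s) (f s (u s, memoryOp k u s))) (Iio t) := fun t =>
    (integrableOn_Iio_iff_integrableOn_Ioi S (fun s => f s (u s, memoryOp k u s)) t).2 <|
      hS.integrableOn_apply hfu.continuous.stronglyMeasurable hd t
  have integral_eq : ∀ t, ∫ s in Iio t, S (t - s) (f s (u s, memoryOp k u s)) = mildMap S k f u t :=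
    setIntegral_Iio_eq_kernelConv S fun s => f s (u s, memoryOp k u s)
  simp only [IsMildSolution, integrable_memory, integrable_mild, integral_eq, implies_true,
    true_and, funext_iff, eq_comm]

theorem norm_mildMap_sub_le (hS : IsIntegrableKernel S b) (hk : IntegrableOn k (Ioi 0))
    (hf : IsAAAParam f)
    (hfL : ∀ t u v x y, ‖f t (u, x) - f t (v, y)‖ ≤ L * (‖u - v‖ + ‖x - y‖))
    (hu : IsAAA u) (hv : IsAAA v) {e : ℝ} (he : ∀ t, ‖u t - v t‖ ≤ e) (t : ℝ) :
    ‖mildMap S k f u t - mildMap S k f v t‖ ≤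
      (∫ s in Ioi (0 : ℝ), b s) * (L * (1 + ∫ s in Ioi (0 : ℝ), ‖k s‖)) * e := by
  have hL := fun t => lipschitzWith_of_norm_sub_le_mul_add (hfL t)
  have memory_le : ∀ t, ‖memoryOp k u t - memoryOp k v t‖ ≤ (∫ s in Ioi (0 : ℝ), ‖k s‖) * e := by
    simpa only [memoryOp_eq_kernelConv] using
      (isIntegrableKernel_smul_id hk).norm_kernelConv_sub_le hu hv he
  rw [mul_assoc]
  refine hS.norm_kernelConv_sub_le (isAAA_superposition_memoryOp hk hf hL hu)
    (isAAA_superposition_memoryOp hk hf hL hv) (fun t => ?_) t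
  calc ‖f t (u t, memoryOp k u t) - f t (v t, memoryOp k v t)‖
      ≤ L * (e + (∫ s in Ioi (0 : ℝ), ‖k s‖) * e) := (hfL _ _ _ _ _).trans <|
        mul_le_mul_of_nonneg_left (add_le_add (he t) (memory_le t)) L.coe_nonneg
    _ = L * (1 + ∫ s in Ioi (0 : ℝ), ‖k s‖) * e := by ring

theorem existsUnique_isAAA_isMildSolution [CompleteSpace X] (hS : IsIntegrableKernel S b)
    (hk : IntegrableOn k (Ioi 0)) (hf : IsAAAParam f)
    (hfL : ∀ t u v x y, ‖f t (u, x) - f t (v, y)‖ ≤ L * (‖u - v‖ + ‖x - y‖))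
    (hlt : (∫ s in Ioi (0 : ℝ), b s) * (L * (1 + ∫ s in Ioi (0 : ℝ), ‖k s‖)) < 1) :
    ∃! u : ℝ → X, IsAAA u ∧ IsMildSolution S k f u := by
  have hL := fun t => lipschitzWith_of_norm_sub_le_mul_add (hfL t)
  have hb : 0 ≤ ∫ s in Ioi (0 : ℝ), b s :=
    setIntegral_nonneg measurableSet_Ioi fun s hs => (norm_nonneg _).trans (hS.norm_le s hs)
  have hq : 0 ≤ (∫ s in Ioi (0 : ℝ), b s) * (L * (1 + ∫ s in Ioi (0 : ℝ), ‖k s‖)) := by positivity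
  have hiff : ∀ u, IsAAA u ∧ IsMildSolution S k f u ↔ IsAAA u ∧ mildMap S k f u = u := fun u =>
    and_congr_right (isMildSolution_iff_mildMap_eq hS hk hf hL)
  exact (existsUnique_congr hiff).2 <| existsUnique_isAAA_fixedPoint (q := ⟨_, hq⟩)
    (by exact_mod_cast hlt)
    (fun u hu => hS.isAAA_kernelConv (isAAA_superposition_memoryOp hk hf hL hu))
    (fun u v e hu hv he => norm_mildMap_sub_le hS hk hf hfL hu hv he)

end FixedPoint

theorem theorem3p3 {X : Type*} [NormedAddCommGroup X] [NormedSpace ℂ X] [CompleteSpace X]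
    (α : ℝ) (hα₁ : 1 < α) (hα₂ : α < 2)
    (A : X →ₗ.[ℂ] X) (hdense : Dense (A.domain : Set X))
    (ω θ M : ℝ) (hω : ω < 0) (hA : IsSectorial A ω θ M)
    (hθ : θ < Real.pi * (1 - α / 2))
    -- the half-opening angle of the integration path of `S_α`
    (φ : ℝ) (hφ₁ : Real.pi / 2 < φ) (hφ₂ : α * φ < Real.pi - θ)
    (hS : ∀ x : X, ContinuousOn (fun t => solutionOp A α φ t x) (Set.Ici 0)) :
    (∃ C : ℝ, 0 < C ∧
      ∀ t : ℝ, 0 ≤ t → ‖solutionOp A α φ t‖ ≤ C * M / (1 + |ω| * t ^ α)) ∧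
    ∀ C : ℝ, 0 < C →
      (∀ t : ℝ, 0 ≤ t → ‖solutionOp A α φ t‖ ≤ C * M / (1 + |ω| * t ^ α)) →
      ∀ (k : ℝ → ℂ), MeasureTheory.IntegrableOn k (Set.Ioi 0) →
      ∀ (f : ℝ → X × X → X), IsAAAParam f →
      ∀ (L : ℝ), 0 < L →
        (∀ (t : ℝ) (u v x y : X), ‖f t (u, x) - f t (v, y)‖ ≤ L * (‖u - v‖ + ‖x - y‖)) →
        C * M * |ω| ^ (-(1 / α)) * Real.pi / (α * Real.sin (Real.pi / α))
          * (L * (1 + ∫ s in Set.Ioi (0 : ℝ), ‖k s‖)) < 1 →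
        ∃! u : ℝ → X, IsAAA u ∧ IsMildSolution (solutionOp A α φ) k f u := by
  refine ⟨hA.exists_norm_solutionOp_le hω hα₁ hφ₁ hφ₂ hS, ?_⟩
  intro C _ hdecay k hk f hf L hL hfL hlt
  lift L to ℝ≥0 using hL.le
  have hω' : 0 < |ω| := abs_pos.2 hω.ne
  have hkernel : IsIntegrableKernel (solutionOp A α φ)
      fun t => C * M * (1 / (1 + |ω| * t ^ α)) :=
    { aestronglyMeasurable := fun x =>
        ((hS x).mono Ioi_subset_Ici_self).aestronglyMeasurable measurableSet_Ioi
      norm_le := fun t ht => by simpa only [mul_one_div] using hdecay t ht.le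
      integrableOn := (integrableOn_one_div_one_add_mul_rpow hα₁ hω').const_mul _ }
  refine existsUnique_isAAA_isMildSolution hkernel hk hf hfL ?_
  rwa [integral_const_mul, integral_one_div_one_add_mul_rpow hα₁ hω', ← mul_div_assoc,
    ← mul_assoc (C * M)]
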